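/- All graphs are finite, undirected and loopless, and are considered up to isomorphism. For graphs $G,H$ let $G+H$ denote their disjoint union and $GH$ their strong product: the graph on $V(G)\times V(H)$ in which distinct $(u,v)$, $(u',v')$ are adjacent if and only if $u,u'$ are equal or adjacent in $G$ and $v,v'$ are equal or adjacent in $H$. With these operations the (isomorphism classes of) graphs form a commutative semiring, whose zero is the graph without vertices and whose unit is the one-vertex graph, so that $p(G_1,\ldots,G_n)$ is defined for every polynomial $p\in\mathbb{N}[x_1,\ldots,x_n]$, where $\mathbb{N}=\{0,1,2,\ldots\}$. Let $\alpha(G)$ be the maximum cardinality of a set of pairwise nonadjacent vertices of $G$, and let $\Theta(G)=\sup_{k\ge 1}\alpha(G^k)^{1/k}$ be the Shannon capacity of $G$. Theorem. Let $n\ge 0$, let $G_1,\ldots,G_n$ be graphs, each with at least one vertex, and let $$\mathcal{P}=\{p\in\mathbb{N}[x_1,\ldots,x_n] : \Theta(p(G_1,\ldots,G_n))=p(\Theta(G_1),\ldots,\Theta(G_n))\}.$$ Then $\mathcal{P}=\mathbb{N}[x_1,\ldots,x_n]$ if and only if $\mathcal{P}$ contains a polynomial in which all variables $x_1,\ldots,x_n$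 occur. -/

import Mathlib

universe u v

namespace SimpleGraph

/-- The strong product of two graphs: distinct pairs are adjacent iff in each coordinate
their entries are equal or adjacent. -/
def strongProd {V : Type u} {W : Type v} (G : SimpleGraph V) (H : SimpleGraph W) :
    SimpleGraph (V × W) where
  Adj x y := x ≠ y ∧ (x.1 = y.1 ∨ G.Adj x.1 y.1) ∧ (x.2 = y.2 ∨ H.Adj x.2 y.2)
  symm := ⟨fun _ _ h =>
    ⟨h.1.symm, h.2.1.imp Eq.symm (fun a => a.symm), h.2.2.imp Eq.symm (fun a => a.symm)⟩⟩
  loopless := ⟨fun _ h => h.1 rfl⟩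

end SimpleGraph

/-- A finite simple graph (undirected, loopless) together with its vertex set, which may be
empty. -/
structure FinGraph : Type (u + 1) where
  V : Type u
  fin : Finite V
  graph : SimpleGraph V

namespace FinGraph

instance isoSetoid : Setoid FinGraph.{u} where
  r A B := Nonempty (A.graph ≃g B.graph)
  iseqv := ⟨fun _ => ⟨SimpleGraph.Iso.refl⟩, fun ⟨e⟩ => ⟨e.symm⟩, fun ⟨e⟩ ⟨f⟩ => ⟨e.trans f⟩⟩

/-- Disjoint union. -/
def sum (A B : FinGraph.{u}) : FinGraph.{u} :=
  ⟨A.V ⊕ B.V, haveI := A.fin; haveI := B.fin; inferInstance, A.graph.sum B.graph⟩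

/-- Strong product. -/
def prod (A B : FinGraph.{u}) : FinGraph.{u} :=
  ⟨A.V × B.V, haveI := A.fin; haveI := B.fin; inferInstance, A.graph.strongProd B.graph⟩

/-- The graph without vertices. -/
def empty : FinGraph.{u} := ⟨PEmpty.{u + 1}, inferInstance, ⊥⟩

/-- The one-vertex graph. -/
def point : FinGraph.{u} := ⟨PUnit.{u + 1}, inferInstance, ⊥⟩

theorem sum_congr {A A' B B' : FinGraph.{u}} (hA : A ≈ A') (hB : B ≈ B') :
    sum A B ≈ sum A' B' := by
  obtain ⟨e⟩ := hA
  obtain ⟨f⟩ := hB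
  have he (a b : A.V) : A'.graph.Adj (e a) (e b) ↔ A.graph.Adj a b := e.map_adj_iff
  have hf (a b : B.V) : B'.graph.Adj (f a) (f b) ↔ B.graph.Adj a b := f.map_adj_iff
  change Nonempty (A.graph.sum B.graph ≃g A'.graph.sum B'.graph)
  refine ⟨⟨Equiv.sumCongr e.toEquiv f.toEquiv, ?_⟩⟩
  rintro (a | a) (b | b) <;> simp [he, hf]

theorem prod_congr {A A' B B' : FinGraph.{u}} (hA : A ≈ A') (hB : B ≈ B') :
    prod A B ≈ prod A' B' := by
  obtain ⟨e⟩ := hA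
  obtain ⟨f⟩ := hB
  have he (a b : A.V) : A'.graph.Adj (e a) (e b) ↔ A.graph.Adj a b := e.map_adj_iff
  have hf (a b : B.V) : B'.graph.Adj (f a) (f b) ↔ B.graph.Adj a b := f.map_adj_iff
  change Nonempty (A.graph.strongProd B.graph ≃g A'.graph.strongProd B'.graph)
  refine ⟨⟨Equiv.prodCongr e.toEquiv f.toEquiv, ?_⟩⟩
  rintro ⟨a, b⟩ ⟨c, d⟩
  simp [SimpleGraph.strongProd, he, hf]

theorem sum_comm (A B : FinGraph.{u}) : sum A B ≈ sum B A := by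
  change Nonempty (A.graph.sum B.graph ≃g B.graph.sum A.graph)
  refine ⟨⟨Equiv.sumComm _ _, ?_⟩⟩
  rintro (a | a) (b | b) <;> simp

theorem sum_assoc (A B C : FinGraph.{u}) : sum (sum A B) C ≈ sum A (sum B C) := by
  change Nonempty ((A.graph.sum B.graph).sum C.graph ≃g A.graph.sum (B.graph.sum C.graph))
  refine ⟨⟨Equiv.sumAssoc _ _ _, ?_⟩⟩
  rintro ((a | a) | a) ((b | b) | b) <;> simp

theorem empty_sum (A : FinGraph.{u}) : sum empty A ≈ A := by
  change Nonempty ((⊥ : SimpleGraph PEmpty.{u + 1}).sum A.graph ≃g A.graph)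
  refine ⟨⟨Equiv.emptySum PEmpty.{u + 1} A.V, ?_⟩⟩
  rintro (⟨⟨⟩⟩ | a) (⟨⟨⟩⟩ | b)
  simp

theorem prod_comm (A B : FinGraph.{u}) : prod A B ≈ prod B A := by
  change Nonempty (A.graph.strongProd B.graph ≃g B.graph.strongProd A.graph)
  refine ⟨⟨Equiv.prodComm _ _, ?_⟩⟩
  rintro ⟨a, b⟩ ⟨c, d⟩
  simp [SimpleGraph.strongProd]
  tauto

theorem prod_assoc (A B C : FinGraph.{u}) : prod (prod A B) C ≈ prod A (prod B C) := by
  change Nonempty ((A.graph.strongProd B.graph).strongProd C.graph ≃g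
    A.graph.strongProd (B.graph.strongProd C.graph))
  refine ⟨⟨Equiv.prodAssoc _ _ _, ?_⟩⟩
  rintro ⟨⟨a, b⟩, c⟩ ⟨⟨a', b'⟩, c'⟩
  simp [SimpleGraph.strongProd]
  tauto

theorem point_prod (A : FinGraph.{u}) : prod point A ≈ A := by
  change Nonempty ((⊥ : SimpleGraph PUnit.{u + 1}).strongProd A.graph ≃g A.graph)
  refine ⟨⟨Equiv.punitProd A.V, ?_⟩⟩
  rintro ⟨⟨⟩, a⟩ ⟨⟨⟩, b⟩
  have := A.graph.ne_of_adj (a := a) (b := b)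
  simp [SimpleGraph.strongProd]
  tauto

theorem empty_prod (A : FinGraph.{u}) : prod empty A ≈ empty := by
  change Nonempty ((⊥ : SimpleGraph PEmpty.{u + 1}).strongProd A.graph ≃g
    (⊥ : SimpleGraph PEmpty.{u + 1}))
  refine ⟨⟨Equiv.pemptyProd A.V, ?_⟩⟩
  rintro ⟨⟨⟩, a⟩

theorem sum_prod (A B C : FinGraph.{u}) :
    prod (sum A B) C ≈ sum (prod A C) (prod B C) := by
  change Nonempty ((A.graph.sum B.graph).strongProd C.graph ≃g
    (A.graph.strongProd C.graph).sum (B.graph.strongProd C.graph))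
  refine ⟨⟨Equiv.sumProdDistrib _ _ _, ?_⟩⟩
  rintro ⟨a | a, c⟩ ⟨b | b, d⟩ <;> simp [SimpleGraph.strongProd]

/-- The stable set number. -/
noncomputable def stableNumber (A : FinGraph.{u}) : ℕ := A.graph.indepNum

theorem stableNumber_le {A B : FinGraph.{u}} (h : A ≈ B) : stableNumber A ≤ stableNumber B := by
  classical
  obtain ⟨e⟩ := h
  have := B.fin
  obtain ⟨s, hs⟩ := have := A.fin; A.graph.exists_isNIndepSet_indepNum
  have hi : B.graph.IsIndepSet ((s.map e.toEquiv.toEmbedding : Finset B.V) : Set B.V) := by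
    intro x hx y hy hxy hadj
    simp only [Finset.coe_map, Set.mem_image, Finset.mem_coe] at hx hy
    obtain ⟨a, ha, rfl⟩ := hx
    obtain ⟨b, hb, rfl⟩ := hy
    exact hs.isIndepSet ha hb (fun hab => hxy (by rw [hab])) (e.map_adj_iff.1 hadj)
  have := hi.card_le_indepNum
  rwa [Finset.card_map, hs.card_eq] at this

end FinGraph

/-- Isomorphism classes of finite graphs. -/
def GraphClass : Type (u + 1) := Quotient FinGraph.isoSetoid.{u}

namespace GraphClass

/-- The isomorphism class of a finite graph. -/
def of {V : Type u} [h : Finite V] (G : SimpleGraph V) : GraphClass.{u} :=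
  Quotient.mk _ ⟨V, h, G⟩

instance : Add GraphClass.{u} :=
  ⟨Quotient.map₂ FinGraph.sum (fun _ _ h _ _ k => FinGraph.sum_congr h k)⟩

instance : Mul GraphClass.{u} :=
  ⟨Quotient.map₂ FinGraph.prod (fun _ _ h _ _ k => FinGraph.prod_congr h k)⟩

instance : Zero GraphClass.{u} := ⟨Quotient.mk _ FinGraph.empty⟩

instance : One GraphClass.{u} := ⟨Quotient.mk _ FinGraph.point⟩

/-- Isomorphism classes of finite graphs form a commutative semiring: addition is disjoint
union, multiplication is the strong product, `0` is the graph without vertices and `1` is the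
one-vertex graph. -/
instance : CommSemiring GraphClass.{u} where
  nsmul := nsmulRec
  add_assoc := by rintro ⟨a⟩ ⟨b⟩ ⟨c⟩; exact Quotient.sound (FinGraph.sum_assoc a b c)
  add_comm := by rintro ⟨a⟩ ⟨b⟩; exact Quotient.sound (FinGraph.sum_comm a b)
  zero_add := by rintro ⟨a⟩; exact Quotient.sound (FinGraph.empty_sum a)
  add_zero := by
    rintro ⟨a⟩
    exact Quotient.sound (Setoid.trans (FinGraph.sum_comm a _) (FinGraph.empty_sum a))
  mul_assoc := by rintro ⟨a⟩ ⟨b⟩ ⟨c⟩; exact Quotient.sound (FinGraph.prod_assoc a b c)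
  mul_comm := by rintro ⟨a⟩ ⟨b⟩; exact Quotient.sound (FinGraph.prod_comm a b)
  one_mul := by rintro ⟨a⟩; exact Quotient.sound (FinGraph.point_prod a)
  mul_one := by
    rintro ⟨a⟩
    exact Quotient.sound (Setoid.trans (FinGraph.prod_comm a _) (FinGraph.point_prod a))
  zero_mul := by rintro ⟨a⟩; exact Quotient.sound (FinGraph.empty_prod a)
  mul_zero := by
    rintro ⟨a⟩
    exact Quotient.sound (Setoid.trans (FinGraph.prod_comm a _) (FinGraph.empty_prod a))
  right_distrib := by rintro ⟨a⟩ ⟨b⟩ ⟨c⟩; exact Quotient.sound (FinGraph.sum_prod a b c)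
  left_distrib := by
    rintro ⟨a⟩ ⟨b⟩ ⟨c⟩
    exact Quotient.sound (Setoid.trans (FinGraph.prod_comm a _)
      (Setoid.trans (FinGraph.sum_prod b c a)
        (FinGraph.sum_congr (FinGraph.prod_comm b a) (FinGraph.prod_comm c a))))

/-- The stable set number `α`, which is invariant under isomorphism. -/
noncomputable def stableNumber : GraphClass.{u} → ℕ :=
  Quotient.lift FinGraph.stableNumber (fun _ _ h =>
    le_antisymm (FinGraph.stableNumber_le h) (FinGraph.stableNumber_le (Setoid.symm h)))

/-- The Shannon capacity `Θ(G) = sup_{k ≥ 1} α(G ^ k) ^ (1 / k)`; the supremum is over a set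
bounded by the number of vertices. -/
noncomputable def shannonCapacity (x : GraphClass.{u}) : ℝ :=
  ⨆ k : ℕ+, (stableNumber (x ^ (k : ℕ)) : ℝ) ^ (1 / ((k : ℕ) : ℝ))

end GraphClass

/-- The polynomials `p` over `ℕ` in `n` variables with
`Θ(p(G₁, …, Gₙ)) = p(Θ(G₁), …, Θ(Gₙ))`. -/
def capacityPolynomials {n : ℕ} {V : Fin n → Type u} [∀ i, Finite (V i)]
    (G : ∀ i, SimpleGraph (V i)) : Set (MvPolynomial (Fin n) ℕ) :=
  {p | GraphClass.shannonCapacity (MvPolynomial.aeval (fun i => GraphClass.of (G i)) p) =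
    MvPolynomial.aeval (fun i => GraphClass.shannonCapacity (GraphClass.of (G i))) p}

/-! `Θ` is superadditive and supermultiplicative, so `p(Θ(G)) ≤ Θ(p(G))` always holds and only the
reverse bound, `IsCapacityBounded`, is at stake. That bound passes from `p` to its powers, to its
summands, and to its factors when the cofactor has positive value, as the lower bound for the
discarded part can be cancelled. If every variable occurs in `p`, each monomial divides a monomial
of some power of `p`, so all monomials satisfy the bound. Since `α` is additive, `α(q(G)) ≤ q(Θ(G))`
follows for every `q`; applied to all powers of `q`, it bounds `Θ(q(G))`. -/

namespace SimpleGraph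

/-! ### Independence numbers of sums and strong products. -/

variable {V : Type u} {W : Type v} [Finite V] [Finite W]

theorem indepNum_sum (G : SimpleGraph V) (H : SimpleGraph W) :
    (G.sum H).indepNum = G.indepNum + H.indepNum := by
  classical
  apply le_antisymm
  · obtain ⟨s, hs⟩ := (G.sum H).exists_isNIndepSet_indepNum
    have hl : G.IsIndepSet (s.toLeft : Set V) := by
      intro x hx y hy hxy hadj
      exact hs.isIndepSet (Finset.mem_coe.2 (Finset.mem_toLeft.1 hx))
        (Finset.mem_coe.2 (Finset.mem_toLeft.1 hy)) (by simpa using hxy) (by simpa using hadj)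
    have hr : H.IsIndepSet (s.toRight : Set W) := by
      intro x hx y hy hxy hadj
      exact hs.isIndepSet (Finset.mem_coe.2 (Finset.mem_toRight.1 hx))
        (Finset.mem_coe.2 (Finset.mem_toRight.1 hy)) (by simpa using hxy) (by simpa using hadj)
    rw [← hs.card_eq, ← Finset.card_toLeft_add_card_toRight]
    exact add_le_add hl.card_le_indepNum hr.card_le_indepNum
  · obtain ⟨s, hs⟩ := G.exists_isNIndepSet_indepNum
    obtain ⟨t, ht⟩ := H.exists_isNIndepSet_indepNum
    have h : (G.sum H).IsIndepSet (s.disjSum t : Set (V ⊕ W)) := by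
      rintro (x | x) hx (y | y) hy hxy hadj
      · exact hs.isIndepSet (by simpa using hx) (by simpa using hy) (by simpa using hxy)
          (by simpa using hadj)
      · simp at hadj
      · simp at hadj
      · exact ht.isIndepSet (by simpa using hx) (by simpa using hy) (by simpa using hxy)
          (by simpa using hadj)
    simpa [Finset.card_disjSum, hs.card_eq, ht.card_eq] using h.card_le_indepNum

theorem indepNum_mul_le_strongProd (G : SimpleGraph V) (H : SimpleGraph W) :
    G.indepNum * H.indepNum ≤ (G.strongProd H).indepNum := by
  classical
  obtain ⟨s, hs⟩ := G.exists_isNIndepSet_indepNum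
  obtain ⟨t, ht⟩ := H.exists_isNIndepSet_indepNum
  have h : (G.strongProd H).IsIndepSet (s ×ˢ t : Finset (V × W)) := by
    rintro ⟨a, b⟩ hx ⟨c, d⟩ hy hxy ⟨-, h₁, h₂⟩
    simp only [Finset.coe_product, Set.mem_prod, Finset.mem_coe] at hx hy
    dsimp only at h₁ h₂
    have hac : a = c := by
      by_contra hne
      exact hs.isIndepSet hx.1 hy.1 hne (h₁.resolve_left hne)
    have hbd : b = d := by
      by_contra hne
      exact ht.isIndepSet hx.2 hy.2 hne (h₂.resolve_left hne)
    exact hxy (by rw [hac, hbd])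
  simpa [Finset.card_product, hs.card_eq, ht.card_eq] using h.card_le_indepNum

theorem indepNum_pos [Nonempty V] (G : SimpleGraph V) : 0 < G.indepNum := by
  obtain ⟨v⟩ := ‹Nonempty V›
  have h : G.IsIndepSet (({v} : Finset V) : Set V) := by simp [IsIndepSet]
  have := h.card_le_indepNum
  rw [Finset.card_singleton] at this
  exact this

theorem indepNum_le_natCard (G : SimpleGraph V) : G.indepNum ≤ Nat.card V := by
  obtain ⟨s, hs⟩ := G.exists_isNIndepSet_indepNum
  rw [← hs.card_eq, ← Nat.card_eq_finsetCard s]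
  exact Nat.card_le_card_of_injective _ Subtype.val_injective

end SimpleGraph

/-- If `y < x`, then `(y / x) ^ k` drops below `C`. Constant factors thus do not affect growth
rates. -/
theorem le_of_forall_const_mul_pow_le {C x y : ℝ} (hC : 0 < C) (hy : 0 ≤ y)
    (h : ∀ k : ℕ, C * x ^ k ≤ y ^ k) : x ≤ y := by
  by_contra! hlt
  have hx0 : 0 < x := hy.trans_lt hlt
  obtain ⟨k, hk⟩ := exists_pow_lt_of_lt_one hC ((div_lt_one hx0).2 hlt)
  rw [div_pow, div_lt_iff₀ (pow_pos hx0 k)] at hk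
  exact absurd (h k) (not_le.2 hk)

/-! ### Stable set number and capacity of isomorphism classes. -/

namespace GraphClass

variable (A B : GraphClass.{u})

theorem stableNumber_add : stableNumber (A + B) = stableNumber A + stableNumber B := by
  obtain ⟨a⟩ := A
  obtain ⟨b⟩ := B
  have := a.fin
  have := b.fin
  exact SimpleGraph.indepNum_sum a.graph b.graph

theorem stableNumber_mul_le : stableNumber A * stableNumber B ≤ stableNumber (A * B) := by
  obtain ⟨a⟩ := A
  obtain ⟨b⟩ := B
  have := a.fin
  have := b.fin
  exact SimpleGraph.indepNum_mul_le_strongProd a.graph b.graph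

theorem stableNumber_zero : stableNumber (0 : GraphClass.{u}) = 0 := by
  have := stableNumber_add (0 : GraphClass.{u}) 0
  rw [add_zero] at this
  omega

theorem stableNumber_one : stableNumber (1 : GraphClass.{u}) = 1 := by
  apply le_antisymm
  · have := (⊥ : SimpleGraph PUnit.{u + 1}).indepNum_le_natCard
    rwa [Nat.card_unique] at this
  · exact (⊥ : SimpleGraph PUnit.{u + 1}).indepNum_pos

/-- The stable set number as an additive homomorphism. -/
noncomputable def stableNumberHom : GraphClass.{u} →+ ℕ where
  toFun := stableNumber
  map_zero' := stableNumber_zero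
  map_add' := stableNumber_add

theorem stableNumber_natCast_mul (c : ℕ) : stableNumber (c * A) = c * stableNumber A := by
  rw [← nsmul_eq_mul, ← smul_eq_mul]
  exact map_nsmul stableNumberHom c A

variable {A} in
theorem eq_zero_of_stableNumber_eq_zero (h : stableNumber A = 0) : A = 0 := by
  obtain ⟨a⟩ := A
  have := a.fin
  have : IsEmpty a.V := by
    by_contra hne
    rw [not_isEmpty_iff] at hne
    exact a.graph.indepNum_pos.ne' h
  refine Quotient.sound ⟨⟨Equiv.equivPEmpty a.V, ?_⟩⟩
  intro x
  exact isEmptyElim x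

theorem stableNumber_of_pos {V : Type u} [Finite V] [Nonempty V] (G : SimpleGraph V) :
    0 < stableNumber (of G) :=
  G.indepNum_pos

theorem exists_stableNumber_pow_le : ∃ N : ℕ, ∀ k : ℕ, stableNumber (A ^ k) ≤ N ^ k := by
  obtain ⟨a⟩ := A
  refine ⟨Nat.card a.V, fun k => ?_⟩
  have key : ∃ b : FinGraph.{u}, (of a.graph (h := a.fin)) ^ k = of b.graph (h := b.fin) ∧
      Nat.card b.V = Nat.card a.V ^ k := by
    induction k with
    | zero => exact ⟨FinGraph.point, pow_zero _, by simp [FinGraph.point]⟩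
    | succ k ih =>
      obtain ⟨b, hb, hc⟩ := ih
      refine ⟨b.prod a, ?_, ?_⟩
      · rw [pow_succ, hb]
        rfl
      · rw [pow_succ, ← hc]
        exact Nat.card_prod _ _
  obtain ⟨b, hb, hc⟩ := key
  have := b.fin
  rw [← hc]
  refine le_trans (le_of_eq ?_) b.graph.indepNum_le_natCard
  exact congrArg stableNumber hb

theorem stableNumber_pow_le_pow (k : ℕ) : stableNumber A ^ k ≤ stableNumber (A ^ k) := by
  induction k with
  | zero => simp [stableNumber_one]
  | succ k ih =>
    rw [pow_succ, pow_succ]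
    exact (Nat.mul_le_mul_right _ ih).trans (stableNumber_mul_le _ _)

/-- Needed because the real `⨆` of an unbounded family is the default value `0`. -/
theorem bddAbove_range_stableNumber_rpow : BddAbove (Set.range fun k : ℕ+ =>
    (stableNumber (A ^ (k : ℕ)) : ℝ) ^ (1 / ((k : ℕ) : ℝ))) := by
  obtain ⟨N, hN⟩ := exists_stableNumber_pow_le A
  refine ⟨N, ?_⟩
  rintro _ ⟨k, rfl⟩
  dsimp only
  rw [one_div]
  refine (Real.rpow_inv_le_iff_of_pos (by positivity) (by positivity)
    (by exact_mod_cast k.pos)).2 ?_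
  rw [Real.rpow_natCast]
  exact_mod_cast hN k

theorem stableNumber_pow_le_shannonCapacity_pow (k : ℕ) :
    (stableNumber (A ^ k) : ℝ) ≤ shannonCapacity A ^ k := by
  rcases Nat.eq_zero_or_pos k with rfl | hk
  · simp [stableNumber_one]
  have h := le_ciSup (bddAbove_range_stableNumber_rpow A) ⟨k, hk⟩
  have h' := pow_le_pow_left₀ (by positivity) h k
  rwa [PNat.mk_coe, one_div, Real.rpow_inv_natCast_pow (by positivity) hk.ne'] at h'

theorem stableNumber_le_shannonCapacity : (stableNumber A : ℝ) ≤ shannonCapacity A := by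
  simpa using stableNumber_pow_le_shannonCapacity_pow A 1

theorem shannonCapacity_nonneg : 0 ≤ shannonCapacity A :=
  (Nat.cast_nonneg _).trans (stableNumber_le_shannonCapacity A)

variable {A B} in
theorem shannonCapacity_le {t : ℝ} (ht : 0 ≤ t)
    (h : ∀ k : ℕ, (stableNumber (A ^ k) : ℝ) ≤ t ^ k) : shannonCapacity A ≤ t := by
  refine ciSup_le fun k => ?_
  rw [one_div]
  refine (Real.rpow_inv_le_iff_of_pos (by positivity) ht (by exact_mod_cast k.pos)).2 ?_
  rw [Real.rpow_natCast]
  exact h k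

variable {A} in
-- Some `a` has `s ^ a < α(A ^ a)`. Division of `k` by `a` extends this to all exponents; the
-- remainder costs at most the factor `max 1 s ^ a`.
theorem exists_const_mul_pow_le_stableNumber {s : ℝ} (hs : 0 < s) (h : s < shannonCapacity A) :
    ∃ C > 0, ∀ k : ℕ, C * s ^ k ≤ (stableNumber (A ^ k) : ℝ) := by
  obtain ⟨⟨a, ha⟩, hlt⟩ := exists_lt_of_lt_ciSup h
  rw [PNat.mk_coe, one_div, Real.lt_rpow_inv_iff_of_pos hs.le (by positivity)
    (by exact_mod_cast ha), Real.rpow_natCast] at hlt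
  have hM : 0 < max 1 s ^ a := by positivity
  refine ⟨(max 1 s ^ a)⁻¹, inv_pos.2 hM, fun k => ?_⟩
  -- A vanishing stable set number would force `A ^ (k % a) = 0`, hence `A ^ a = 0`.
  have hr : 1 ≤ stableNumber (A ^ (k % a)) := by
    rw [Nat.one_le_iff_ne_zero]
    intro h0
    have hz : A ^ a = 0 := by
      rw [← Nat.add_sub_of_le (Nat.mod_lt k ha).le, pow_add, eq_zero_of_stableNumber_eq_zero h0,
        zero_mul]
    rw [hz, stableNumber_zero, Nat.cast_zero] at hlt
    exact absurd hlt (not_lt.2 (pow_pos hs a).le)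
  have hk : (stableNumber (A ^ a) : ℝ) ^ (k / a) ≤ stableNumber (A ^ k) := by
    have h₁ : stableNumber (A ^ a) ^ (k / a) * stableNumber (A ^ (k % a)) ≤
        stableNumber (A ^ k) := by
      calc _ ≤ stableNumber ((A ^ a) ^ (k / a)) * stableNumber (A ^ (k % a)) :=
            Nat.mul_le_mul_right _ (stableNumber_pow_le_pow _ _)
        _ ≤ _ := stableNumber_mul_le _ _
        _ = _ := by rw [← pow_mul, ← pow_add, Nat.div_add_mod]
    exact_mod_cast (Nat.le_mul_of_pos_right _ hr).trans h₁
  have hmod : s ^ (k % a) ≤ max 1 s ^ a :=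
    (pow_le_pow_left₀ hs.le (le_max_right 1 s) _).trans
      (pow_le_pow_right₀ (le_max_left 1 s) (Nat.mod_lt k ha).le)
  rw [inv_mul_le_iff₀ hM]
  calc s ^ k = s ^ (k % a) * (s ^ a) ^ (k / a) := by
        rw [← pow_mul, ← pow_add, Nat.mod_add_div]
    _ ≤ max 1 s ^ a * stableNumber (A ^ k) := by
        refine mul_le_mul hmod ((pow_le_pow_left₀ (pow_nonneg hs.le a) hlt.le _).trans hk)
          (by positivity) hM.le

variable {A} in
-- The alternative `s = 0` covers `Θ(A) = 0`, where no nonnegative `s` lies below the capacity.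
theorem exists_const_mul_pow_le_stableNumber' {s : ℝ} (hs : 0 ≤ s)
    (h : s < shannonCapacity A ∨ s = 0) :
    ∃ C > 0, ∀ k : ℕ, C * s ^ k ≤ (stableNumber (A ^ k) : ℝ) := by
  rcases hs.eq_or_lt with rfl | hs
  · refine ⟨1, one_pos, fun k => ?_⟩
    rcases k with _ | k
    · simp [stableNumber_one]
    · simp
  · exact exists_const_mul_pow_le_stableNumber hs (h.resolve_right hs.ne')

theorem stableNumber_sum {ι : Type*} (s : Finset ι) (f : ι → GraphClass.{u}) :
    stableNumber (∑ i ∈ s, f i) = ∑ i ∈ s, stableNumber (f i) :=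
  map_sum stableNumberHom f s

variable {A B} in
-- In the binomial expansion of `(A + B) ^ k` every term obeys the lower bound with the same
-- constant `C * D`, so the terms add up to `C * D * (s + t) ^ k`.
theorem add_le_shannonCapacity_add {s t : ℝ} (hs : 0 ≤ s) (ht : 0 ≤ t)
    (hsA : s < shannonCapacity A ∨ s = 0) (htB : t < shannonCapacity B ∨ t = 0) :
    s + t ≤ shannonCapacity (A + B) := by
  obtain ⟨C, hC, hCs⟩ := exists_const_mul_pow_le_stableNumber' hs hsA
  obtain ⟨D, hD, hDt⟩ := exists_const_mul_pow_le_stableNumber' ht htB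
  refine le_of_forall_const_mul_pow_le (mul_pos hC hD)
    (shannonCapacity_nonneg _) fun k => ?_
  refine le_trans ?_ (stableNumber_pow_le_shannonCapacity_pow (A + B) k)
  rw [add_pow, add_pow, stableNumber_sum, Finset.mul_sum, Nat.cast_sum]
  refine Finset.sum_le_sum fun i _ => ?_
  rw [mul_comm (A ^ i * B ^ (k - i)), stableNumber_natCast_mul, Nat.cast_mul]
  calc C * D * (s ^ i * t ^ (k - i) * (k.choose i : ℝ))
      = k.choose i * ((C * s ^ i) * (D * t ^ (k - i))) := by ring
    _ ≤ k.choose i * (stableNumber (A ^ i) * stableNumber (B ^ (k - i))) := by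
        gcongr
        · exact hCs i
        · exact hDt _
    _ ≤ _ := by
        gcongr
        exact_mod_cast stableNumber_mul_le _ _

variable {A B} in
theorem mul_le_shannonCapacity_mul {s t : ℝ} (hs : 0 ≤ s) (ht : 0 ≤ t)
    (hsA : s < shannonCapacity A ∨ s = 0) (htB : t < shannonCapacity B ∨ t = 0) :
    s * t ≤ shannonCapacity (A * B) := by
  obtain ⟨C, hC, hCs⟩ := exists_const_mul_pow_le_stableNumber' hs hsA
  obtain ⟨D, hD, hDt⟩ := exists_const_mul_pow_le_stableNumber' ht htB
  refine le_of_forall_const_mul_pow_le (mul_pos hC hD)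
    (shannonCapacity_nonneg _) fun k => ?_
  refine le_trans ?_ (stableNumber_pow_le_shannonCapacity_pow (A * B) k)
  calc C * D * (s * t) ^ k = (C * s ^ k) * (D * t ^ k) := by rw [mul_pow]; ring
    _ ≤ stableNumber (A ^ k) * stableNumber (B ^ k) := by
        gcongr
        · exact hCs k
        · exact hDt k
    _ ≤ _ := by
        rw [mul_pow]
        exact_mod_cast stableNumber_mul_le _ _

/-- A nonnegative real is a limit of nonnegative reals that are smaller or zero. -/
theorem exists_tendsto_lt_or_eq_zero {x : ℝ} (hx : 0 ≤ x) :
    ∃ f : ℕ → ℝ, Filter.Tendsto f Filter.atTop (nhds x) ∧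
      ∀ n, 0 ≤ f n ∧ (f n < x ∨ f n = 0) := by
  refine ⟨fun n => max 0 (x - 1 / ((n : ℝ) + 1)), ?_, fun n => ⟨le_max_left _ _, ?_⟩⟩
  · have h := (tendsto_one_div_add_atTop_nhds_zero_nat (𝕜 := ℝ)).const_sub x
    have h' := (tendsto_const_nhds (x := (0 : ℝ))).max h
    rwa [sub_zero, max_eq_right hx] at h'
  · rcases max_choice 0 (x - 1 / ((n : ℝ) + 1)) with h | h
    · exact Or.inr h
    · refine Or.inl ?_
      dsimp only
      rw [h]
      exact sub_lt_self _ (by positivity)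

theorem shannonCapacity_add_le :
    shannonCapacity A + shannonCapacity B ≤ shannonCapacity (A + B) := by
  obtain ⟨f, hf, hf'⟩ := exists_tendsto_lt_or_eq_zero (shannonCapacity_nonneg A)
  obtain ⟨g, hg, hg'⟩ := exists_tendsto_lt_or_eq_zero (shannonCapacity_nonneg B)
  exact le_of_tendsto' (hf.add hg) fun n =>
    add_le_shannonCapacity_add (hf' n).1 (hg' n).1 (hf' n).2 (hg' n).2

theorem shannonCapacity_mul_le :
    shannonCapacity A * shannonCapacity B ≤ shannonCapacity (A * B) := by
  obtain ⟨f, hf, hf'⟩ := exists_tendsto_lt_or_eq_zero (shannonCapacity_nonneg A)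
  obtain ⟨g, hg, hg'⟩ := exists_tendsto_lt_or_eq_zero (shannonCapacity_nonneg B)
  exact le_of_tendsto' (hf.mul hg) fun n =>
    mul_le_shannonCapacity_mul (hf' n).1 (hg' n).1 (hf' n).2 (hg' n).2

theorem shannonCapacity_pow_le (k : ℕ) : shannonCapacity (A ^ k) ≤ shannonCapacity A ^ k := by
  refine shannonCapacity_le (pow_nonneg (shannonCapacity_nonneg A) k) fun j => ?_
  rw [← pow_mul, ← pow_mul]
  exact stableNumber_pow_le_shannonCapacity_pow A (k * j)

end GraphClass

/-! ### Splitting monomials off polynomials over `ℕ`. -/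

namespace MvPolynomial

variable {σ : Type*}

/-- A nonzero coefficient in `ℕ` is at least `1`, so one copy of the monomial splits off as a
genuine summand. -/
theorem exists_eq_monomial_add {p : MvPolynomial σ ℕ} {m : σ →₀ ℕ} (hm : m ∈ p.support) :
    ∃ r, p = monomial m 1 + r := by
  classical
  refine ⟨monomial m (coeff m p - 1) +
    ∑ v ∈ p.support.erase m, monomial v (coeff v p), ?_⟩
  have h1 : 1 + (coeff m p - 1) = coeff m p :=
    Nat.add_sub_of_le (Nat.one_le_iff_ne_zero.2 (mem_support_iff.1 hm))
  rw [← add_assoc, ← map_add, h1,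
    Finset.add_sum_erase p.support (fun v => monomial v (coeff v p)) hm,
    support_sum_monomial_coeff]

theorem exists_prod_eq_prod_monomial_add {ι : Type*} (s : Finset ι) (f : ι → MvPolynomial σ ℕ)
    (m : ι → σ →₀ ℕ) (h : ∀ i ∈ s, m i ∈ (f i).support) :
    ∃ r, ∏ i ∈ s, f i = monomial (∑ i ∈ s, m i) 1 + r := by
  classical
  induction s using Finset.induction_on with
  | empty => exact ⟨0, by simp⟩
  | insert a s ha ih =>
    obtain ⟨r, hr⟩ := ih fun i hi => h i (Finset.mem_insert_of_mem hi)
    obtain ⟨q, hq⟩ := exists_eq_monomial_add (h a (Finset.mem_insert_self a s))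
    refine ⟨monomial (m a) 1 * r + q * (monomial (∑ i ∈ s, m i) 1 + r), ?_⟩
    rw [Finset.prod_insert ha, Finset.sum_insert ha, hr, hq, ← one_mul (1 : ℕ), ← monomial_mul,
      one_mul]
    ring

end MvPolynomial

/-! ### Transfer of the upper bound between polynomials. -/

open MvPolynomial GraphClass

section

variable {σ : Type*} (A : σ → GraphClass.{u})

theorem aeval_shannonCapacity_nonneg (p : MvPolynomial σ ℕ) :
    0 ≤ aeval (fun i => shannonCapacity (A i)) p := by
  induction p using MvPolynomial.induction_on with
  | C c => simp
  | add p q hp hq =>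
    rw [map_add]
    exact add_nonneg hp hq
  | mul_X p i hp =>
    rw [map_mul, aeval_X]
    exact mul_nonneg hp (shannonCapacity_nonneg _)

theorem aeval_shannonCapacity_le (p : MvPolynomial σ ℕ) :
    aeval (fun i => shannonCapacity (A i)) p ≤ shannonCapacity (aeval A p) := by
  induction p using MvPolynomial.induction_on with
  | C c =>
    have h := stableNumber_le_shannonCapacity ((c : GraphClass.{u}) * 1)
    rw [stableNumber_natCast_mul, stableNumber_one, mul_one, mul_one] at h
    simpa using h
  | add p q hp hq =>
    rw [map_add, map_add]
    exact (add_le_add hp hq).trans (shannonCapacity_add_le _ _)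
  | mul_X p i hp =>
    rw [map_mul, map_mul, aeval_X, aeval_X]
    exact (mul_le_mul_of_nonneg_right hp (shannonCapacity_nonneg _)).trans
      (shannonCapacity_mul_le _ _)

/-- The polynomials whose value at the graphs has Shannon capacity at most the value at the
Shannon capacities. -/
def IsCapacityBounded (p : MvPolynomial σ ℕ) : Prop :=
  shannonCapacity (aeval A p) ≤ aeval (fun i => shannonCapacity (A i)) p

variable {A}

theorem IsCapacityBounded.pow {p : MvPolynomial σ ℕ} (h : IsCapacityBounded A p) (k : ℕ) :
    IsCapacityBounded A (p ^ k) := by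
  unfold IsCapacityBounded at *
  rw [map_pow, map_pow]
  exact (shannonCapacity_pow_le _ k).trans
    (pow_le_pow_left₀ (shannonCapacity_nonneg _) h k)

theorem IsCapacityBounded.of_add {p q : MvPolynomial σ ℕ} (h : IsCapacityBounded A (p + q)) :
    IsCapacityBounded A p := by
  unfold IsCapacityBounded at *
  rw [map_add, map_add] at h
  linarith [shannonCapacity_add_le (aeval A p) (aeval A q), aeval_shannonCapacity_le A q]

theorem IsCapacityBounded.of_mul {p q : MvPolynomial σ ℕ} (h : IsCapacityBounded A (p * q))
    (hq : 0 < aeval (fun i => shannonCapacity (A i)) q) : IsCapacityBounded A p := by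
  unfold IsCapacityBounded at *
  rw [map_mul, map_mul] at h
  refine le_of_mul_le_mul_right ?_ hq
  exact (mul_le_mul_of_nonneg_left (aeval_shannonCapacity_le A q)
    (shannonCapacity_nonneg _)).trans ((shannonCapacity_mul_le _ _).trans h)

theorem isCapacityBounded_of_monomial (h : ∀ m, IsCapacityBounded A (monomial m 1))
    (p : MvPolynomial σ ℕ) : IsCapacityBounded A p := by
  -- The bound is proved for `α` first, because `α` is exactly additive while `Θ` is only
  -- superadditive.
  have key (q : MvPolynomial σ ℕ) :
      (stableNumber (aeval A q) : ℝ) ≤ aeval (fun i => shannonCapacity (A i)) q := by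
    induction q using MvPolynomial.induction_on' with
    | monomial m c =>
      have hm := (stableNumber_le_shannonCapacity _).trans (h m)
      have hc : monomial m c = c • monomial m (1 : ℕ) := by rw [smul_monomial]; simp
      rw [hc, map_nsmul, map_nsmul, nsmul_eq_mul, nsmul_eq_mul, stableNumber_natCast_mul,
        Nat.cast_mul]
      exact mul_le_mul_of_nonneg_left hm (Nat.cast_nonneg c)
    | add p q hp hq =>
      rw [map_add, map_add, stableNumber_add, Nat.cast_add]
      exact add_le_add hp hq
  refine shannonCapacity_le (aeval_shannonCapacity_nonneg A p) fun k => ?_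
  rw [← map_pow, ← map_pow]
  exact key (p ^ k)

theorem IsCapacityBounded.of_forall_mem_vars [Fintype σ] (hA : ∀ i, 0 < shannonCapacity (A i))
    {p : MvPolynomial σ ℕ} (hp : IsCapacityBounded A p) (hv : ∀ i, i ∈ p.vars)
    (q : MvPolynomial σ ℕ) : IsCapacityBounded A q := by
  refine isCapacityBounded_of_monomial (fun e => ?_) q
  choose m hm hmi using fun i => (mem_vars_iff_mem_support i).1 (hv i)
  -- In a power of `p` with `K` factors for each variable `i`, choosing the monomial `m i` from
  -- those factors yields this summand.
  have hM (K : ℕ) : IsCapacityBounded A (monomial (K • ∑ i, m i) 1) := by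
    obtain ⟨r, hr⟩ := exists_prod_eq_prod_monomial_add (Finset.univ ×ˢ Finset.range K)
      (fun _ : σ × ℕ => p) (fun i => m i.1) fun i _ => hm i.1
    rw [Finset.prod_const, Finset.sum_product] at hr
    simp only [Finset.sum_const, Finset.card_range, ← Finset.smul_sum] at hr
    exact (hr ▸ hp.pow _).of_add
  -- Every variable has exponent at least `1` in `∑ i, m i`, so the total degree of `e` suffices as
  -- multiplier.
  have hle : e ≤ (∑ i, e i) • ∑ i, m i := by
    intro j
    rw [Finsupp.smul_apply, Finsupp.finsetSum_apply, smul_eq_mul]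
    have h1 : 1 ≤ ∑ i, m i j :=
      (Nat.one_le_iff_ne_zero.2 (Finsupp.mem_support_iff.1 (hmi j))).trans
        (Finset.single_le_sum (f := fun i => m i j) (fun _ _ => Nat.zero_le _)
          (Finset.mem_univ j))
    exact (Finset.single_le_sum (f := fun i => e i) (fun _ _ => Nat.zero_le _)
      (Finset.mem_univ j)).trans (Nat.le_mul_of_pos_right _ h1)
  obtain ⟨d, hd⟩ := exists_add_of_le hle
  refine IsCapacityBounded.of_mul (q := monomial d 1) ?_ ?_
  · rw [monomial_mul, ← hd, one_mul]
    exact hM _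
  · rw [aeval_monomial, map_one, one_mul]
    exact Finset.prod_pos fun i _ => pow_pos (hA i) _

end

theorem mainTheorem2 {n : ℕ} {V : Fin n → Type u} [∀ i, Finite (V i)] [∀ i, Nonempty (V i)]
    (G : ∀ i, SimpleGraph (V i)) :
    capacityPolynomials G = Set.univ ↔
      ∃ p ∈ capacityPolynomials G, ∀ i, i ∈ p.vars := by
  constructor
  · intro h
    -- The witness is the product of all variables.
    refine ⟨monomial (Finsupp.equivFunOnFinite.symm fun _ => 1) 1, h ▸ Set.mem_univ _,
      fun i => ?_⟩
    rw [vars_monomial one_ne_zero]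
    simp
  · rintro ⟨p, hp, hv⟩
    refine Set.eq_univ_of_forall fun q => le_antisymm ?_ (aeval_shannonCapacity_le _ q)
    refine IsCapacityBounded.of_forall_mem_vars (fun i => ?_) (le_of_eq hp) hv q
    exact (Nat.cast_pos.2 (stableNumber_of_pos (G i))).trans_le
      (stableNumber_le_shannonCapacity _)
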